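/- Let $\tau\in(0,1)$, let $Y$ be a real random variable, let $\theta_0\in\mathbb{R}$ satisfy $\mathbb{E}\{\psi(Y,\theta_0)\}=0$, where $\psi(y,\theta):=I(y<\theta)-\tau$, and for each $n$ let $\mathbf{X}=\mathbf{X}_{(n)}$ be a random vector in $\mathbb{R}^{p}$ whose dimension $p=p_n$ is allowed to depend on $n$. For each $n$ one observes two independent data sets: the labelled data $(Y_i,\mathbf{X}_i)$, $i=1,\dots,n$, which are $n$ independent copies of $(Y,\mathbf{X})$, and the unlabelled data $\mathbf{X}_i$, $i=n+1,\dots,n+N$, which are $N=N_n$ independent copies of $\mathbf{X}$. Let $r$ be fixed, let $\mathbf{P}_0=\mathbf{P}_{0,n}$ be a $p\times r$ matrix and let $\mathbf{S}:=\mathbf{P}_0^{\rm T}\mathbf{X}$. Suppose that $Y$ has a conditional density $f(\cdot\mid\mathbf{S})=f_n(\cdot\mid\mathbf{S})$ given $\mathbf{S}$ and that, for some $\varepsilon>0$ and every $n$, $$\mathbb{E}\Big[\Big\{\sup_{|\theta-\theta_0|\le\varepsilon} f(\theta\mid\mathbf{S})\Big\}^2\Big]<\infty .$$ Let $\phi(\mathbf{X},\theta):=\mathbb{E}\{\psi(Y,\theta)\mid\mathbf{S}\}$,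 the conditional expectations for all $\theta$ being taken with one regular conditional distribution of $Y$ given $\mathbf{S}$. For $M\in\{n,n+N\}$ and a (possibly random) function $g$ write $$\mathbb{G}_M\{g(\mathbf{X})\}:=M^{1/2}\Big[M^{-1}\sum_{i=1}^{M} g(\mathbf{X}_i)-\int g\,d\mathbb{P}_{\mathbf{X}}\Big],$$ where the integral is taken with $g$ held fixed. Then $\mathbb{E}[\{\phi(\mathbf{X},\theta_0)\}^2]<\infty$ for every $n$, and for any sequence of random variables $\tilde\theta=\tilde\theta_n$ (which may depend on the data) with $\tilde\theta\to\theta_0$ in probability, as $n\to\infty$, $$\mathbb{G}_n\{\phi(\mathbf{X},\tilde\theta)-\phi(\mathbf{X},\theta_0)\}=o_p(1)\quad\text{and}\quad \mathbb{G}_{n+N}\{\phi(\mathbf{X},\tilde\theta)-\phi(\mathbf{X},\theta_0)\}=o_p(1).$$ -/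

import Mathlib

open MeasureTheory ProbabilityTheory Filter Topology
open scoped Matrix ENNReal

/-- The quantile score `ψ(y, θ) = I(y < θ) - τ`. -/
noncomputable def quantileScore (τ y θ : ℝ) : ℝ :=
  (Set.Iio θ).indicator (fun _ => (1 : ℝ)) y - τ

/-- The reduced covariate `S = Aᵀ X`, where `A` is a `p × r` matrix. -/
def reducedCovariate {Ω : Type*} {p r : ℕ} (A : Matrix (Fin p) (Fin r) ℝ)
    (X : Ω → Fin p → ℝ) : Ω → Fin r → ℝ :=
  fun ω => Aᵀ *ᵥ X ω

/-- `f s y` is a conditional density (with respect to Lebesgue measure) of the real random variable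
`Y` given `S = s`: a jointly measurable nonnegative function which, for almost every value `s` of
`S`, is a density of the conditional distribution of `Y` given `S = s`. -/
structure IsCondDensity {Ω E : Type*} [MeasurableSpace Ω] [MeasurableSpace E]
    (P : Measure Ω) [IsFiniteMeasure P] (Y : Ω → ℝ) (S : Ω → E) (f : E → ℝ → ℝ) : Prop where
  measurable : Measurable (Function.uncurry f)
  nonneg : ∀ s y, 0 ≤ f s y
  condDistrib_eq : ∀ᵐ s ∂(P.map S),
    condDistrib Y S P s = volume.withDensity (fun y => ENNReal.ofReal (f s y))

/-- The imputation function `φ(x, θ) = E{ψ(Y, θ) | S = Aᵀ x}`, `S = Aᵀ X`. The conditional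
expectation is taken with the regular conditional distribution of `Y` given `S` (one kernel for all
`θ`), so that a random `θ` may be substituted. -/
noncomputable def condMeanImputation {Ω : Type*} [MeasurableSpace Ω] {p r : ℕ}
    (P : Measure Ω) [IsFiniteMeasure P] (τ : ℝ) (Y : Ω → ℝ) (X : Ω → Fin p → ℝ)
    (A : Matrix (Fin p) (Fin r) ℝ) (x : Fin p → ℝ) (θ : ℝ) : ℝ :=
  ∫ y, quantileScore τ y θ ∂(condDistrib Y (reducedCovariate A X) P (Aᵀ *ᵥ x))

/-- Two independent data sets: the labelled data `(Ys i, Xs i)`, `i < n`, which are `n` independent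
copies of `(Y, X)`, and the unlabelled data `Xs i`, `n ≤ i < n + N`, which are `N` independent
copies of `X`. -/
structure IsSemiSupervisedSample {Ω E : Type*} [MeasurableSpace Ω] [MeasurableSpace E]
    (P : Measure Ω) (Y : Ω → ℝ) (X : Ω → E) (n N : ℕ)
    (Ys : ℕ → Ω → ℝ) (Xs : ℕ → Ω → E) : Prop where
  labelled_identDistrib : ∀ i < n,
    IdentDistrib (fun ω => (Ys i ω, Xs i ω)) (fun ω => (Y ω, X ω)) P P
  unlabelled_identDistrib : ∀ i, n ≤ i → i < n + N → IdentDistrib (Xs i) X P P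
  labelled_iIndepFun : iIndepFun (fun (i : Fin n) ω => (Ys i ω, Xs i ω)) P
  unlabelled_iIndepFun : iIndepFun (fun (i : Fin N) ω => Xs (n + i) ω) P
  indepFun : IndepFun (fun ω (i : Fin n) => (Ys i ω, Xs i ω))
    (fun ω (i : Fin N) => Xs (n + i) ω) P

/-- The empirical process `G_M(g) = M^{1/2} [M⁻¹ ∑_{i < M} g(w_i) - ∫ g dμ]` of the points
`w_0, …, w_{M-1}`, centred at the distribution `μ`. -/
noncomputable def empiricalProcess {E : Type*} [MeasurableSpace E] (μ : Measure E) (M : ℕ)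
    (w : ℕ → E) (g : E → ℝ) : ℝ :=
  Real.sqrt M * ((M : ℝ)⁻¹ * ∑ i ∈ Finset.range M, g (w i) - ∫ x, g x ∂μ)

/-- The condition on an imputation function `φ`: `φ(X, θ₀)` is square integrable and, for every
sequence of random variables `θ̃ → θ₀` in probability, `G_n{φ(X, θ̃) - φ(X, θ₀)}` and
`G_{n+N}{φ(X, θ̃) - φ(X, θ₀)}` are `o_p(1)` as `n → ∞`. In the centring term of `G` the value of
`θ̃` is held fixed. The dimension `p n` of the covariate, the covariate `X n`, its copies `Xs n i`
and the function `φ n` may depend on `n`; `N n` is the size of the unlabelled sample. -/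
def ImputationCondition {Ω : Type*} [MeasurableSpace Ω] (P : Measure Ω) (θ₀ : ℝ) (N : ℕ → ℕ)
    {p : ℕ → ℕ} (X : ∀ n, Ω → Fin (p n) → ℝ) (Xs : ∀ n, ℕ → Ω → Fin (p n) → ℝ)
    (φ : ∀ n, (Fin (p n) → ℝ) → ℝ → ℝ) : Prop :=
  (∀ n, MemLp (fun ω => φ n (X n ω) θ₀) 2 P) ∧
  ∀ θt : ℕ → Ω → ℝ, (∀ n, AEMeasurable (θt n) P) →
    TendstoInMeasure P θt atTop (fun _ => θ₀) →
    TendstoInMeasure P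
      (fun n ω => empiricalProcess (P.map (X n)) n (fun i => Xs n i ω)
        (fun x => φ n x (θt n ω) - φ n x θ₀)) atTop (fun _ => 0) ∧
    TendstoInMeasure P
      (fun n ω => empiricalProcess (P.map (X n)) (n + N n) (fun i => Xs n i ω)
        (fun x => φ n x (θt n ω) - φ n x θ₀)) atTop (fun _ => 0)

/-! Up to the constant `τ`, which cancels in differences, `φ(x, ·)` is the conditional distribution
function of `Y` given `S`: it is nondecreasing, has values in `[0, 1]`, and its mean under the law
of `X n` is `H θ = P(Y < θ)`, whatever `n` and `p n` are. The conditional density enters by making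
the law of `Y` atomless, hence `H` continuous.

Monotonicity replaces any entropy condition. In the coordinate `u = H θ + θ` means of increments are
at most the length of the step. An increment with mean at most `h` has fourth empirical-process
moment at most `3h² + h/M`, which is of order `h²` while `hM ≥ 1`; this is small enough for dyadic
chaining. Chaining stops at a mesh where `√M * h` is of the order of the target accuracy, and
monotonicity controls all points between grid points. The supremum over a window of length `L` then
exceeds `10η` with probability at most `28L²/η⁴`
(`measureReal_exists_lt_abs_empiricalProcess_sub_le`). A fixed short window around `θ₀` catches `θ̃`
with probability tending to one, so any dependence of `θ̃` on the data is harmless. -/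

/-! ### Independence and moments of sums -/

/-- Concatenating two independent finite families of independent random variables gives an
independent family. -/
theorem iIndepFun_fin_add {Ω E : Type*} [MeasurableSpace Ω] [MeasurableSpace E] {P : Measure Ω}
    {n N : ℕ} {X : ℕ → Ω → E}
    (h₁ : iIndepFun (fun (i : Fin n) => X i) P)
    (h₂ : iIndepFun (fun (i : Fin N) => X (n + i)) P)
    (h : IndepFun (fun ω (i : Fin n) => X i ω) (fun ω (i : Fin N) => X (n + i) ω) P) :
    iIndepFun (fun (i : Fin (n + N)) => X i) P := by
  classical
  rw [iIndepFun_iff_measure_inter_preimage_eq_mul] at h₁ h₂ ⊢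
  rw [indepFun_iff_measure_inter_preimage_eq_mul] at h
  intro S A hA
  set S₁ : Finset (Fin n) := {i | Fin.castAdd N i ∈ S} with hS₁
  set S₂ : Finset (Fin N) := {i | Fin.natAdd n i ∈ S} with hS₂
  have hB₁ := h₁ S₁ (sets := fun i => A (Fin.castAdd N i)) (by
    intro i hi; exact hA _ (by simpa [hS₁] using hi))
  have hB₂ := h₂ S₂ (sets := fun i => A (Fin.natAdd n i)) (by
    intro i hi; exact hA _ (by simpa [hS₂] using hi))
  have hm₁ : MeasurableSet (⋂ i ∈ S₁, (fun x : Fin n → E => x i) ⁻¹' A (Fin.castAdd N i)) :=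
    Finset.measurableSet_biInter _ fun i hi =>
      (measurable_pi_apply i) (hA _ (by simpa [hS₁] using hi))
  have hm₂ : MeasurableSet (⋂ i ∈ S₂, (fun x : Fin N → E => x i) ⁻¹' A (Fin.natAdd n i)) :=
    Finset.measurableSet_biInter _ fun i hi =>
      (measurable_pi_apply i) (hA _ (by simpa [hS₂] using hi))
  have key := h _ _ hm₁ hm₂
  simp only [Set.preimage_iInter, ← Set.preimage_comp, Function.comp_def] at key
  have e₁ : ∏ i ∈ S, P ((fun ω => X i ω) ⁻¹' A i)
      = (∏ i ∈ S₁, P ((fun ω => X i ω) ⁻¹' A (Fin.castAdd N i)))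
        * ∏ i ∈ S₂, P ((fun ω => X (n + i) ω) ⁻¹' A (Fin.natAdd n i)) := by
    rw [← Finset.univ_inter S, ← Finset.prod_ite_mem, Fin.prod_univ_add, hS₁, hS₂,
      Finset.prod_filter, Finset.prod_filter]
    simp
  have e₂ : (⋂ i ∈ S, (fun ω => X i ω) ⁻¹' A i)
      = (⋂ i ∈ S₁, (fun ω => X i ω) ⁻¹' A (Fin.castAdd N i))
        ∩ ⋂ i ∈ S₂, (fun ω => X (n + i) ω) ⁻¹' A (Fin.natAdd n i) := by
    ext ω
    simp only [Set.mem_iInter, Set.mem_inter_iff, Set.mem_preimage, hS₁, hS₂,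
      Finset.mem_filter, Finset.mem_univ, true_and]
    rw [Fin.forall_fin_add]
    simp
  exact (congrArg P e₂).trans (key.trans ((congrArg₂ (· * ·) hB₁ hB₂).trans e₁.symm))

/-- Second and fourth moment bounds for sums of bounded independent centred variables. -/
theorem integral_sum_pow_le {Ω ι : Type*} [MeasurableSpace Ω] {P : Measure Ω}
    [IsProbabilityMeasure P] {ξ : ι → Ω → ℝ} {v : ℝ} (hv : 0 ≤ v)
    (hmeas : ∀ i, AEMeasurable (ξ i) P) (hbdd : ∀ i ω, |ξ i ω| ≤ 1)
    (hmean : ∀ i, ∫ ω, ξ i ω ∂P = 0) (hvar : ∀ i, ∫ ω, ξ i ω ^ 2 ∂P ≤ v)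
    (hind : iIndepFun ξ P) (s : Finset ι) :
    ∫ ω, (∑ i ∈ s, ξ i ω) ∂P = 0 ∧
    ∫ ω, (∑ i ∈ s, ξ i ω) ^ 2 ∂P ≤ s.card * v ∧
    ∫ ω, (∑ i ∈ s, ξ i ω) ^ 4 ∂P ≤ 3 * s.card ^ 2 * v ^ 2 + s.card * v := by
  classical
  induction s using Finset.induction_on with
  | empty => simp
  | insert a s ha ih =>
    obtain ⟨ih1, ih2, ih4⟩ := ih
    set T : Ω → ℝ := fun ω => ∑ i ∈ s, ξ i ω with hT
    have hTm : AEMeasurable T P := Finset.aemeasurable_fun_sum s fun i _ => hmeas i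
    have hTb : ∀ ω, |T ω| ≤ s.card := fun ω =>
      (Finset.abs_sum_le_sum_abs _ _).trans
        ((Finset.sum_le_sum fun i _ => hbdd i ω).trans (by simp))
    have hI : IndepFun T (ξ a) P := by
      have := hind.indepFun_finsetSum_of_notMem₀ hmeas ha
      convert this using 1
      ext ω; simp [hT]
    have hmix : ∀ j k : ℕ, Integrable (fun ω => T ω ^ j * ξ a ω ^ k) P ∧
        ∫ ω, T ω ^ j * ξ a ω ^ k ∂P = (∫ ω, T ω ^ j ∂P) * ∫ ω, ξ a ω ^ k ∂P := by
      intro j k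
      constructor
      · refine Integrable.of_bound (C := (s.card : ℝ) ^ j)
          ((hTm.pow_const j).mul ((hmeas a).pow_const k)).aestronglyMeasurable
          (Eventually.of_forall fun ω => ?_)
        rw [Real.norm_eq_abs, abs_mul, abs_pow, abs_pow]
        calc |T ω| ^ j * |ξ a ω| ^ k ≤ (s.card : ℝ) ^ j * 1 := by
              gcongr
              · exact hTb ω
              · exact pow_le_one₀ (abs_nonneg _) (hbdd a ω)
          _ = _ := mul_one _
      · exact (hI.comp (φ := fun x => x ^ j) (ψ := fun x => x ^ k) (by fun_prop)
          (by fun_prop)).integral_fun_mul_eq_mul_integral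
            (hTm.pow_const j).aestronglyMeasurable ((hmeas a).pow_const k).aestronglyMeasurable
    have i10 := hmix 1 0
    have i01 := hmix 0 1
    have i20 := hmix 2 0
    have i11 := hmix 1 1
    have i02 := hmix 0 2
    have i40 := hmix 4 0
    have i31 := hmix 3 1
    have i22 := hmix 2 2
    have i13 := hmix 1 3
    have i04 := hmix 0 4
    have m4 : ∫ ω, ξ a ω ^ 4 ∂P ≤ v := by
      refine le_trans (integral_mono (by simpa using i04.1) (by simpa using i02.1) fun ω => ?_)
        (hvar a)
      have := hbdd a ω
      have h1 : ξ a ω ^ 2 ≤ 1 := by rw [← sq_abs]; exact pow_le_one₀ (abs_nonneg _) this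
      simp only
      nlinarith [sq_nonneg (ξ a ω)]
    have hm := hmean a
    have hva := hvar a
    have hv0 : 0 ≤ ∫ ω, ξ a ω ^ 2 ∂P := integral_nonneg fun ω => sq_nonneg _
    have hs : ∀ ω, ∑ i ∈ insert a s, ξ i ω = ξ a ω + T ω := fun ω => Finset.sum_insert ha
    have hc : ((insert a s).card : ℝ) = s.card + 1 := by
      rw [Finset.card_insert_of_notMem ha]; push_cast; ring
    have hc0 : (0 : ℝ) ≤ s.card := Nat.cast_nonneg _
    simp only [hs, hc]
    refine ⟨?_, ?_, ?_⟩
    · rw [integral_add (by simpa using i01.1) (by simpa using i10.1), hm, ih1, add_zero]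
    · have e : ∀ ω, (ξ a ω + T ω) ^ 2
          = T ω ^ 0 * ξ a ω ^ 2 + 2 * (T ω ^ 1 * ξ a ω ^ 1) + T ω ^ 2 * ξ a ω ^ 0 := by
        intro ω; ring
      simp only [e]
      rw [integral_add (i02.1.fun_add (i11.1.const_mul 2)) i20.1,
        integral_add i02.1 (i11.1.const_mul 2), integral_const_mul, i02.2, i11.2, i20.2]
      simp [hm]
      linarith
    · have e : ∀ ω, (ξ a ω + T ω) ^ 4
          = T ω ^ 4 * ξ a ω ^ 0 + 4 * (T ω ^ 3 * ξ a ω ^ 1) + 6 * (T ω ^ 2 * ξ a ω ^ 2)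
            + 4 * (T ω ^ 1 * ξ a ω ^ 3) + T ω ^ 0 * ξ a ω ^ 4 := by
        intro ω; ring
      simp only [e]
      have I1 := i31.1.const_mul 4
      have I2 := i22.1.const_mul 6
      have I3 := i13.1.const_mul 4
      rw [integral_add (((i40.1.fun_add I1).fun_add I2).fun_add I3) i04.1,
        integral_add ((i40.1.fun_add I1).fun_add I2) I3, integral_add (i40.1.fun_add I1) I2,
        integral_add i40.1 I1, integral_const_mul, integral_const_mul, integral_const_mul,
        i40.2, i31.2, i22.2, i13.2, i04.2]
      -- The terms `T³ξ` and `Tξ³` vanish because both factors are centred; `6T²ξ²` contributes at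
      -- most `6 * s.card * v²`, which fits into `3(s.card + 1)² - 3 s.card²`.
      have h22 : (∫ ω, T ω ^ 2 ∂P) * ∫ ω, ξ a ω ^ 2 ∂P ≤ s.card * v * v := by gcongr
      simp only [pow_one, pow_zero, integral_const, probReal_univ, smul_eq_mul, mul_one, one_mul,
        hm, mul_zero, add_zero, show ∫ ω, T ω ∂P = 0 from ih1, zero_mul]
      nlinarith [sq_nonneg v]

/-! ### Moments and tails of the empirical process -/

theorem integrable_of_mem_Icc {E : Type*} [MeasurableSpace E] {μ : Measure E} [IsFiniteMeasure μ]
    {D : E → ℝ} (hD : Measurable D) (h : ∀ x, D x ∈ Set.Icc (0 : ℝ) 1) : Integrable D μ :=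
  Integrable.of_bound (C := 1) hD.aestronglyMeasurable (Eventually.of_forall fun x => by
    rw [Real.norm_eq_abs, abs_of_nonneg (h x).1]; exact (h x).2)

theorem empiricalProcess_sub {E : Type*} [MeasurableSpace E] {μ : Measure E} {g h : E → ℝ}
    (hg : Integrable g μ) (hh : Integrable h μ) (M : ℕ) (w : ℕ → E) :
    empiricalProcess μ M w (fun x => g x - h x)
      = empiricalProcess μ M w g - empiricalProcess μ M w h := by
  simp only [empiricalProcess, Finset.sum_sub_distrib, integral_sub hg hh]
  ring

theorem aemeasurable_empiricalProcess {Ω E : Type*} [MeasurableSpace Ω] [MeasurableSpace E]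
    {P : Measure Ω} {μ : Measure E} {X : ℕ → Ω → E} {M : ℕ}
    (hX : ∀ i < M, AEMeasurable (X i) P) {D : E → ℝ} (hD : Measurable D) :
    AEMeasurable (fun ω => empiricalProcess μ M (fun i => X i ω) D) P := by
  have : AEMeasurable (fun ω => ∑ i ∈ Finset.range M, D (X i ω)) P :=
    Finset.aemeasurable_fun_sum _ fun i hi =>
      hD.comp_aemeasurable (hX i (Finset.mem_range.1 hi))
  exact ((this.const_mul _).sub_const _).const_mul _

section Moments

variable {Ω E : Type*} [MeasurableSpace Ω] [MeasurableSpace E]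
  {P : Measure Ω} [IsProbabilityMeasure P] {μ : Measure E} [IsProbabilityMeasure μ]
  {X : ℕ → Ω → E} {M : ℕ}

/-- Fourth moment of the empirical process at a function with values in `[0, 1]` and small mean. -/
theorem integral_empiricalProcess_pow_four_le (hM : 0 < M)
    (hX : ∀ i < M, AEMeasurable (X i) P) (hmap : ∀ i < M, P.map (X i) = μ)
    (hind : iIndepFun (fun (i : Fin M) => X i) P)
    {D : E → ℝ} (hD : Measurable D) (hD01 : ∀ x, D x ∈ Set.Icc (0 : ℝ) 1) {h : ℝ}
    (hh : ∫ x, D x ∂μ ≤ h) :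
    ∫ ω, (empiricalProcess μ M (fun i => X i ω) D) ^ 4 ∂P ≤ 3 * h ^ 2 + h / M := by
  set m := ∫ x, D x ∂μ with hm
  have hDi : Integrable D μ := integrable_of_mem_Icc hD hD01
  have hm0 : 0 ≤ m := integral_nonneg fun x => (hD01 x).1
  have hm1 : m ≤ 1 := by
    refine (integral_mono hDi (integrable_const 1) fun x => (hD01 x).2).trans ?_
    simp
  have hh0 : 0 ≤ h := hm0.trans hh
  have htrans : ∀ (i : Fin M) (F : E → ℝ), Measurable F →
      ∫ ω, F (X i ω) ∂P = ∫ x, F x ∂μ := by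
    intro i F hF
    rw [← hmap i i.2, integral_map (hX i i.2) hF.aestronglyMeasurable]
  have key := (integral_sum_pow_le (P := P) (ξ := fun (i : Fin M) ω => D (X i ω) - m) hh0
    (fun i => (hD.comp_aemeasurable (hX i i.2)).sub_const m)
    (fun i ω => by
      have := hD01 (X i ω)
      rw [abs_le]; constructor <;> linarith [this.1, this.2])
    (fun i => by
      rw [htrans i (fun x => D x - m) (hD.sub_const m), integral_sub hDi (integrable_const m)]
      simp [hm])
    (fun i => by
      rw [htrans i (fun x => (D x - m) ^ 2) ((hD.sub_const m).pow_const 2)]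
      have hb : Integrable (fun x => D x - 2 * m * D x + m ^ 2) μ :=
        (hDi.sub (hDi.const_mul _)).add (integrable_const _)
      -- Since `D² ≤ D` on `[0, 1]`, the variance is at most `m - m²`, hence at most `h`.
      calc ∫ x, (D x - m) ^ 2 ∂μ ≤ ∫ x, (D x - 2 * m * D x + m ^ 2) ∂μ := by
            refine integral_mono_of_nonneg (Eventually.of_forall fun x => sq_nonneg _) hb
              (Eventually.of_forall fun x => ?_)
            have := hD01 x
            simp only
            nlinarith [this.1, this.2]
        _ = m - 2 * m * m + m ^ 2 := by
            have hDs : Integrable (fun x => D x - 2 * m * D x) μ := hDi.sub (hDi.const_mul _)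
            rw [integral_add hDs (integrable_const _),
              integral_sub hDi (hDi.const_mul _), integral_const_mul]
            simp [hm]
        _ ≤ h := by nlinarith)
    (hind.comp (fun _ x => D x - m) fun _ => hD.sub_const m) Finset.univ).2.2
  rw [Finset.card_univ, Fintype.card_fin] at key
  have hM' : (0 : ℝ) < M := Nat.cast_pos.2 hM
  have e : ∀ ω, (empiricalProcess μ M (fun i => X i ω) D) ^ 4
      = ((M : ℝ) ^ 2)⁻¹ * (∑ i : Fin M, (D (X i ω) - m)) ^ 4 := by
    intro ω
    have hs : √(M : ℝ) ^ 2 = M := Real.sq_sqrt hM'.le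
    have e1 : ∑ i : Fin M, (D (X i ω) - m) = (∑ i ∈ Finset.range M, D (X i ω)) - M * m := by
      rw [Finset.sum_sub_distrib, Finset.sum_range fun i => D (X i ω)]
      simp
    have e2 : (M : ℝ)⁻¹ * ∑ i ∈ Finset.range M, D (X i ω) - m
        = (M : ℝ)⁻¹ * ((∑ i ∈ Finset.range M, D (X i ω)) - M * m) := by
      field_simp
    rw [empiricalProcess, ← hm, e2, e1, mul_pow, mul_pow,
      show √(M : ℝ) ^ 4 = (√(M : ℝ) ^ 2) ^ 2 by ring, hs]
    field_simp
  simp only [e]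
  rw [integral_const_mul]
  calc ((M : ℝ) ^ 2)⁻¹ * ∫ ω, (∑ i : Fin M, (D (X i ω) - m)) ^ 4 ∂P
      ≤ ((M : ℝ) ^ 2)⁻¹ * (3 * (M : ℝ) ^ 2 * h ^ 2 + M * h) := by gcongr
    _ = 3 * h ^ 2 + h / M := by field_simp

/-- Markov's inequality for the fourth power. A second moment would only give order `h`, which the
union bound over `2 ^ j` increments of length `L / 2 ^ j` could not absorb. -/
theorem measureReal_lt_abs_empiricalProcess_le (hM : 0 < M)
    (hX : ∀ i < M, AEMeasurable (X i) P) (hmap : ∀ i < M, P.map (X i) = μ)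
    (hind : iIndepFun (fun (i : Fin M) => X i) P)
    {D : E → ℝ} (hD : Measurable D) (hD01 : ∀ x, D x ∈ Set.Icc (0 : ℝ) 1) {h : ℝ}
    (hh : ∫ x, D x ∂μ ≤ h) {c : ℝ} (hc : 0 < c) :
    P.real {ω | c < |(empiricalProcess μ M (fun i => X i ω) D)|} ≤ (3 * h ^ 2 + h / M) / c ^ 4 := by
  set G : Ω → ℝ := fun ω => empiricalProcess μ M (fun i => X i ω) D with hG
  have hGm : AEMeasurable G P := aemeasurable_empiricalProcess hX hD
  have hGb : ∀ ω, |G ω| ≤ √M * 2 := by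
    intro ω
    have hM' : (0 : ℝ) < M := Nat.cast_pos.2 hM
    rw [hG]; simp only [empiricalProcess]
    rw [abs_mul, abs_of_nonneg (Real.sqrt_nonneg _)]
    gcongr
    have h1 : 0 ≤ ∑ i ∈ Finset.range M, D (X i ω) := Finset.sum_nonneg fun i _ => (hD01 _).1
    have h2 : ∑ i ∈ Finset.range M, D (X i ω) ≤ M :=
      (Finset.sum_le_sum fun i _ => (hD01 (X i ω)).2).trans (by simp)
    have h3 : 0 ≤ (M : ℝ)⁻¹ * ∑ i ∈ Finset.range M, D (X i ω) := by positivity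
    have h4 : (M : ℝ)⁻¹ * ∑ i ∈ Finset.range M, D (X i ω) ≤ 1 := by
      rw [inv_mul_le_iff₀ hM']; linarith
    have h5 : 0 ≤ ∫ x, D x ∂μ := integral_nonneg fun x => (hD01 x).1
    have h6 : ∫ x, D x ∂μ ≤ 1 := by
      refine (integral_mono (integrable_of_mem_Icc hD hD01) (integrable_const 1)
        fun x => (hD01 x).2).trans ?_
      simp
    rw [abs_le]; constructor <;> linarith
  have hGi : Integrable (fun ω => G ω ^ 4) P :=
    Integrable.of_bound (C := (√M * 2) ^ 4) (hGm.pow_const 4).aestronglyMeasurable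
      (Eventually.of_forall fun ω => by
        rw [Real.norm_eq_abs, abs_pow]; exact pow_le_pow_left₀ (abs_nonneg _) (hGb ω) 4)
  have hmk := mul_meas_ge_le_integral_of_nonneg (μ := P) (f := fun ω => G ω ^ 4)
    (Eventually.of_forall fun ω => by positivity) hGi (c ^ 4)
  have h4 := integral_empiricalProcess_pow_four_le hM hX hmap hind hD hD01 hh
  rw [le_div_iff₀ (by positivity), mul_comm]
  refine le_trans ?_ (hmk.trans h4)
  refine mul_le_mul_of_nonneg_left (measureReal_mono ?_) (by positivity)
  · intro ω (hω : c < |G ω|)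
    change c ^ 4 ≤ G ω ^ 4
    calc c ^ 4 ≤ |G ω| ^ 4 := pow_le_pow_left₀ hc.le hω.le 4
      _ = G ω ^ 4 := by rw [← abs_pow, abs_of_nonneg (by positivity)]

end Moments

/-! ### Chaining and the maximal inequality -/

/-- Dyadic chaining: if the increments of `Z` between neighbouring dyadic points of level `j ≤ K`
have small tails, then `Z` stays close to its starting value on the dyadic grid of level `K`. -/
theorem measureReal_dyadic_chain_le {Ω : Type*} [MeasurableSpace Ω] {P : Measure Ω}
    [IsProbabilityMeasure P] (Z : ℝ → Ω → ℝ) (b L c C : ℝ) (hc : 0 ≤ c) (hC : 0 ≤ C) (K : ℕ)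
    (hZ : ∀ j ≤ K, ∀ k : ℕ, k < 2 ^ j →
      P.real {ω | c * (7 / 8) ^ j <
        |Z (b + (k + 1) * (L / 2 ^ j)) ω - Z (b + k * (L / 2 ^ j)) ω|}
      ≤ C * (1024 / 2401) ^ j) :
    P.real {ω | ∃ k : ℕ, k ≤ 2 ^ K ∧ 8 * c < |Z (b + k * (L / 2 ^ K)) ω - Z b ω|} ≤ 7 * C := by
  set B : ℕ → ℕ → Set Ω := fun j k => {ω | c * (7 / 8) ^ j <
    |Z (b + (k + 1) * (L / 2 ^ j)) ω - Z (b + k * (L / 2 ^ j)) ω|} with hB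
  have hsub : {ω | ∃ k : ℕ, k ≤ 2 ^ K ∧ 8 * c < |Z (b + k * (L / 2 ^ K)) ω - Z b ω|}
      ⊆ ⋃ j ∈ Finset.range (K + 1), ⋃ k ∈ Finset.range (2 ^ j), B j k := by
    intro ω hω
    by_contra hn
    simp only [Set.mem_iUnion, Finset.mem_range, not_exists, hB, Set.mem_ofPred_eq, not_lt] at hn
    -- The thresholds `c(7/8)^i` sum over `i ≤ j` to `8c(1 - (7/8)^(j+1))`. An even-indexed point
    -- already lies on the coarser grid; an odd one is a single increment away from its left
    -- neighbour, which does.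
    have hchain : ∀ j ≤ K, ∀ k : ℕ, k ≤ 2 ^ j →
        |Z (b + k * (L / 2 ^ j)) ω - Z b ω| ≤ 8 * c * (1 - (7 / 8) ^ (j + 1)) := by
      intro j
      induction j with
      | zero =>
        intro _ k hk
        rcases Nat.le_one_iff_eq_zero_or_eq_one.1 (by simpa using hk) with rfl | rfl
        · simp; linarith
        · have := hn 0 (by omega) 0 (by simp)
          norm_num at this ⊢
          linarith
      | succ j ih =>
        intro hj k hk
        have ih' := ih (by omega)
        have hpow : c * (7 / 8 : ℝ) ^ (j + 1) = 8 * c * (1 - (7 / 8) ^ (j + 1 + 1))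
            - 8 * c * (1 - (7 / 8) ^ (j + 1)) := by ring
        have hpos : 0 ≤ c * (7 / 8 : ℝ) ^ (j + 1) := by positivity
        obtain ⟨i, rfl | rfl⟩ := Nat.even_or_odd' k
        · have h1 := ih' i (by rw [pow_succ] at hk; omega)
          have e : b + ((2 * i : ℕ) : ℝ) * (L / 2 ^ (j + 1)) = b + i * (L / 2 ^ j) := by
            push_cast; rw [pow_succ]; field_simp
          rw [e]; linarith
        · have hi : 2 * i < 2 ^ (j + 1) := by omega
          have h1 := ih' i (by rw [pow_succ] at hk; omega)
          have h2 := hn (j + 1) (by omega) (2 * i) hi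
          have e : b + ((2 * i : ℕ) : ℝ) * (L / 2 ^ (j + 1)) = b + i * (L / 2 ^ j) := by
            push_cast; rw [pow_succ]; field_simp
          rw [e] at h2
          have e' : (((2 * i + 1 : ℕ)) : ℝ) = ((2 * i : ℕ) : ℝ) + 1 := by push_cast; ring
          rw [e']
          have := abs_sub_le (Z (b + (((2 * i : ℕ) : ℝ) + 1) * (L / 2 ^ (j + 1))) ω)
            (Z (b + i * (L / 2 ^ j)) ω) (Z b ω)
          linarith
    obtain ⟨k, hk, hlt⟩ := hω
    have := hchain K le_rfl k hk
    have h0 : 0 ≤ 8 * c * (7 / 8 : ℝ) ^ (K + 1) := by positivity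
    linarith
  refine (measureReal_mono hsub (measure_ne_top _ _)).trans ((measureReal_biUnion_finset_le _ _).trans ?_)
  have h1 : ∀ j ∈ Finset.range (K + 1), P.real (⋃ k ∈ Finset.range (2 ^ j), B j k)
      ≤ C * (2048 / 2401) ^ j := by
    intro j hj
    refine (measureReal_biUnion_finset_le _ _).trans ?_
    have h2 : ∀ k ∈ Finset.range (2 ^ j), P.real (B j k) ≤ C * (1024 / 2401) ^ j := fun k hk =>
      hZ j (Nat.lt_succ_iff.1 (Finset.mem_range.1 hj)) k (Finset.mem_range.1 hk)
    refine (Finset.sum_le_sum h2).trans (le_of_eq ?_)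
    rw [Finset.sum_const, Finset.card_range, nsmul_eq_mul,
      show (2048 / 2401 : ℝ) = 2 * (1024 / 2401) by norm_num, mul_pow]
    push_cast; ring
  refine (Finset.sum_le_sum h1).trans ?_
  -- The ratio is below one and the full geometric series equals `2401/353 < 7`.
  rw [← Finset.mul_sum, geom_sum_eq (by norm_num)]
  have h2 : (0 : ℝ) ≤ (2048 / 2401) ^ (K + 1) := by positivity
  have h3 : ((2048 / 2401 : ℝ) ^ (K + 1) - 1) / (2048 / 2401 - 1) ≤ 7 := by
    rw [div_le_iff_of_neg (by norm_num)]; linarith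
  calc C * _ ≤ C * 7 := by gcongr
    _ = 7 * C := mul_comm _ _

/-- Maximal inequality for the empirical process indexed by a monotone family of functions with
values in `[0, 1]` whose means are `1`-Lipschitz in the index. -/
theorem measureReal_exists_lt_abs_empiricalProcess_sub_le
    {Ω E : Type*} [MeasurableSpace Ω] [MeasurableSpace E]
    {P : Measure Ω} [IsProbabilityMeasure P] {μ : Measure E} [IsProbabilityMeasure μ]
    {X : ℕ → Ω → E} {M : ℕ}
    (hX : ∀ i < M, AEMeasurable (X i) P) (hmap : ∀ i < M, P.map (X i) = μ)
    (hind : iIndepFun (fun (i : Fin M) => X i) P)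
    {g : E → ℝ → ℝ} (hg : ∀ u, Measurable fun x => g x u)
    (hg01 : ∀ x u, g x u ∈ Set.Icc (0 : ℝ) 1) (hmono : ∀ x, Monotone (g x))
    (hlip : ∀ u v, u ≤ v → ∫ x, (g x v - g x u) ∂μ ≤ v - u)
    {b L η : ℝ} (hη : 0 < η) (hL : 0 < L) (hLM : η ≤ √M * L) (hηM : 1 ≤ √M * η) :
    P.real {ω | ∃ u ∈ Set.Ico b (b + L),
      10 * η < |(empiricalProcess μ M (fun i => X i ω) (fun x => g x u)
        - empiricalProcess μ M (fun i => X i ω) (fun x => g x b))|} ≤ 28 * L ^ 2 / η ^ 4 := by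
  have hM : 0 < M := by
    rcases Nat.eq_zero_or_pos M with rfl | h
    · simp at hηM; linarith
    · exact h
  have hM' : (0 : ℝ) < M := Nat.cast_pos.2 hM
  have hsM : √(M : ℝ) * √(M : ℝ) = M := Real.mul_self_sqrt hM'.le
  have hgi : ∀ u, Integrable (fun x => g x u) μ := fun u => integrable_of_mem_Icc (hg u) (hg01 · u)
  set Z : ℝ → Ω → ℝ := fun u ω => empiricalProcess μ M (fun i => X i ω) (fun x => g x u) with hZ
  -- The empirical sum increases with `u`, so `Z` can drop only through its centring, by at most `√M
  -- (v - u)`.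
  have hZle : ∀ u v, u ≤ v → ∀ ω, Z u ω ≤ Z v ω + √M * (v - u) := by
    intro u v huv ω
    have h1 : Z v ω - Z u ω
        = empiricalProcess μ M (fun i => X i ω) (fun x => g x v - g x u) :=
      (empiricalProcess_sub (hgi v) (hgi u) M _).symm
    have h2 : 0 ≤ (M : ℝ)⁻¹ * ∑ i ∈ Finset.range M, (g (X i ω) v - g (X i ω) u) :=
      mul_nonneg (by positivity) (Finset.sum_nonneg fun i _ => sub_nonneg.2 (hmono _ huv))
    have h3 := hlip u v huv
    have h4 : √(M : ℝ) * (-(v - u)) ≤ Z v ω - Z u ω := by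
      rw [h1, empiricalProcess]
      gcongr
      linarith
    linarith
  -- The finest mesh `h = L / 2 ^ K` satisfies `η ≤ √M * h ≤ 2η`.
  obtain ⟨K, hK1, hK2⟩ := exists_nat_pow_near (x := √M * L / η) (y := 2)
    ((one_le_div₀ hη).2 hLM) (by norm_num)
  have hKη : 2 ^ K * η ≤ √M * L := (le_div_iff₀ hη).1 hK1
  have hKL : √M * (L / 2 ^ K) ≤ 2 * η := by
    rw [div_lt_iff₀ hη, pow_succ] at hK2
    rw [← mul_div_assoc, div_le_iff₀ (by positivity)]
    linarith
  have hlevel : ∀ j ≤ K, ∀ k : ℕ, k < 2 ^ j →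
      P.real {ω | η * (7 / 8) ^ j <
        |Z (b + (k + 1) * (L / 2 ^ j)) ω - Z (b + k * (L / 2 ^ j)) ω|}
      ≤ (4 * L ^ 2 / η ^ 4) * (1024 / 2401) ^ j := by
    intro j hj k _
    have hh0 : 0 < L / 2 ^ j := by positivity
    have hle : b + k * (L / 2 ^ j) ≤ b + (k + 1) * (L / 2 ^ j) := by nlinarith
    have hmean := hlip _ _ hle
    have hdiff : b + (k + 1) * (L / 2 ^ j) - (b + k * (L / 2 ^ j)) = L / 2 ^ j := by ring
    rw [hdiff] at hmean
    have hb := measureReal_lt_abs_empiricalProcess_le hM hX hmap hind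
      ((hg (b + (k + 1) * (L / 2 ^ j))).sub (hg (b + k * (L / 2 ^ j))))
      (fun x => ⟨sub_nonneg.2 (hmono x hle), by
        have h1 := hg01 x (b + (k + 1) * (L / 2 ^ j))
        have h2 := hg01 x (b + k * (L / 2 ^ j))
        simp only [Pi.sub_apply]
        linarith [h1.2, h2.1]⟩) hmean
      (c := η * (7 / 8) ^ j) (by positivity)
    have e : ∀ ω, Z (b + (k + 1) * (L / 2 ^ j)) ω - Z (b + k * (L / 2 ^ j)) ω
        = empiricalProcess μ M (fun i => X i ω)
          ((fun x => g x (b + (k + 1) * (L / 2 ^ j))) - fun x => g x (b + k * (L / 2 ^ j))) :=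
      fun ω => (empiricalProcess_sub (hgi _) (hgi _) M _).symm
    simp only [e]
    refine hb.trans ?_
    -- Down to level `K` steps have length at least `1 / M`, so the `h / M` term is absorbed and the
    -- moment bound becomes `4h²`.
    have hMh : L / 2 ^ j / M ≤ (L / 2 ^ j) ^ 2 := by
      rw [div_le_iff₀ hM', sq, mul_assoc]
      refine le_mul_of_one_le_right hh0.le ?_
      have h1 : L / 2 ^ K ≤ L / 2 ^ j := by
        gcongr
        norm_num
      have h2 : η ≤ √M * (L / 2 ^ K) := by
        rw [← mul_div_assoc, le_div_iff₀ (by positivity)]; linarith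
      calc (1 : ℝ) ≤ √M * η := hηM
        _ ≤ √M * (√M * (L / 2 ^ K)) := by gcongr
        _ = L / 2 ^ K * M := by rw [← mul_assoc, hsM, mul_comm]
        _ ≤ L / 2 ^ j * M := by gcongr
    -- Halving the step divides the moment bound by `4` and the fourth power of the threshold by
    -- `(8/7)^4`; hence the ratio `1024/2401`.
    have e2 : (4 * L ^ 2 / η ^ 4) * (1024 / 2401 : ℝ) ^ j
        = (4 * (L / 2 ^ j) ^ 2) / (η * (7 / 8) ^ j) ^ 4 := by
      rw [show (1024 / 2401 : ℝ) = (1 / 2) ^ 2 / (7 / 8) ^ 4 by norm_num, div_pow _ _ j,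
        pow_right_comm _ 2 j, pow_right_comm _ 4 j, div_pow _ _ j, one_pow]
      field_simp
    rw [e2]
    gcongr
    linarith
  have hchain := measureReal_dyadic_chain_le (P := P) Z b L η (4 * L ^ 2 / η ^ 4) hη.le
    (by positivity) K hlevel
  refine le_trans (measureReal_mono ?_) (hchain.trans (le_of_eq (by ring)))
  rintro ω ⟨u, ⟨hub, huL⟩, hlt⟩
  by_contra hn
  simp only [Set.mem_ofPred_eq, not_exists, not_and, not_lt] at hn
  set h := L / 2 ^ K with hh
  have hh0 : 0 < h := by positivity
  have hhK : 2 ^ K * h = L := by rw [hh]; field_simp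
  set k := ⌊(u - b) / h⌋₊ with hk
  have hk1 : (k : ℝ) * h ≤ u - b :=
    (le_div_iff₀ hh0).1 (Nat.floor_le (div_nonneg (by linarith) hh0.le))
  have hk2 : u - b < (k + 1) * h := (div_lt_iff₀ hh0).1 (Nat.lt_floor_add_one _)
  have hkK : k < 2 ^ K := by
    have : (k : ℝ) < 2 ^ K := lt_of_mul_lt_mul_right (by linarith) hh0.le
    exact_mod_cast this
  -- Between neighbouring grid points `Z` is sandwiched up to `√M * h ≤ 2η`; with `8η` from the
  -- chain this gives `10η`.
  have a1 := abs_le.1 (hn k hkK.le)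
  have a2 := abs_le.1 (hn (k + 1) hkK)
  push_cast at a2
  have z1 := hZle (b + k * h) u (by linarith) ω
  have z2 := hZle u (b + (k + 1) * h) (by linarith) ω
  have m1 : √(M : ℝ) * (u - (b + k * h)) ≤ √M * h := by gcongr; linarith
  have m2 : √(M : ℝ) * (b + (k + 1) * h - u) ≤ √M * h := by gcongr; linarith
  refine absurd hlt (not_lt.2 (abs_le.2 ⟨?_, ?_⟩)) <;> change _ ≤ _ at * <;> linarith

/-! ### Asymptotic equicontinuity -/

/-- Asymptotic equicontinuity, along an arbitrary consistent sequence of indices, of the empirical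
processes of a triangular array indexed by monotone families of functions with values in `[0, 1]`
that share a continuous mean function `H`. -/
theorem tendstoInMeasure_empiricalProcess_sub
    {Ω : Type*} [MeasurableSpace Ω] {P : Measure Ω} [IsProbabilityMeasure P]
    {E : ℕ → Type*} [∀ n, MeasurableSpace (E n)] {μ : ∀ n, Measure (E n)}
    [∀ n, IsProbabilityMeasure (μ n)] {X : ∀ n, ℕ → Ω → E n} {M : ℕ → ℕ}
    (hM : Tendsto M atTop atTop)
    (hX : ∀ n, ∀ i < M n, AEMeasurable (X n i) P) (hmap : ∀ n, ∀ i < M n, P.map (X n i) = μ n)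
    (hind : ∀ n, iIndepFun (fun (i : Fin (M n)) => X n i) P)
    {g : ∀ n, E n → ℝ → ℝ} (hg : ∀ n θ, Measurable fun x => g n x θ)
    (hg01 : ∀ n x θ, g n x θ ∈ Set.Icc (0 : ℝ) 1) (hmono : ∀ n x, Monotone (g n x))
    {H : ℝ → ℝ} (hHc : Continuous H) (hHm : Monotone H)
    (hint : ∀ n θ, ∫ x, g n x θ ∂(μ n) = H θ)
    {θ₀ : ℝ} {θt : ℕ → Ω → ℝ} (hθt : TendstoInMeasure P θt atTop (fun _ => θ₀)) :
    TendstoInMeasure P (fun n ω => empiricalProcess (μ n) (M n) (fun i => X n i ω)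
      (fun x => g n x (θt n ω) - g n x θ₀)) atTop (fun _ => 0) := by
  -- Adding the identity makes `H` strictly increasing and onto, so it can be inverted even where
  -- `H` is flat.
  have hRm : StrictMono fun θ => H θ + θ := hHm.add_strictMono strictMono_id
  have hRc : Continuous fun θ => H θ + θ := hHc.add continuous_id
  have hH01 : ∀ θ, H θ ∈ Set.Icc (0 : ℝ) 1 := by
    intro θ
    rw [← hint 0 θ]
    refine ⟨integral_nonneg fun x => (hg01 0 x θ).1, ?_⟩
    refine (integral_mono (integrable_of_mem_Icc (hg 0 θ) (hg01 0 · θ)) (integrable_const 1)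
      fun x => (hg01 0 x θ).2).trans ?_
    simp
  have hRs : Function.Surjective fun θ => H θ + θ :=
    hRc.surjective
      (tendsto_atTop_mono (fun θ => by simpa using (hH01 θ).1) tendsto_id)
      (tendsto_atBot_mono (fun θ => by simpa [add_comm] using (hH01 θ).2)
        (tendsto_atBot_add_const_right _ 1 tendsto_id))
  let e : ℝ ≃o ℝ := hRm.orderIsoOfSurjective _ hRs
  have he : ∀ θ, e θ = H θ + θ := fun θ => rfl
  have hgi : ∀ n θ, Integrable (fun x => g n x θ) (μ n) :=
    fun n θ => integrable_of_mem_Icc (hg n θ) (hg01 n · θ)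
  have hlip : ∀ n u v, u ≤ v → ∫ x, (g n x (e.symm v) - g n x (e.symm u)) ∂(μ n) ≤ v - u := by
    intro n u v huv
    rw [integral_sub (hgi n _) (hgi n _), hint, hint]
    have h1 := he (e.symm v)
    have h2 := he (e.symm u)
    have h3 := e.symm.monotone huv
    rw [e.apply_symm_apply] at h1 h2
    linarith
  rw [tendstoInMeasure_iff_measureReal_norm] at hθt ⊢
  intro η hη
  rw [Metric.tendsto_atTop']
  intro ε hε
  -- Both `θ̃` and `θ₀` are compared with the left end of the window, at cost `10a` each, and `20a <
  -- η`.
  set a := η / 21 with ha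
  have ha0 : 0 < a := by positivity
  set L := min 1 (ε * a ^ 4 / 100) with hLdef
  have hL0 : 0 < L := lt_min one_pos (by positivity)
  have hLb : 28 * L ^ 2 / a ^ 4 < ε / 2 := by
    have h1 : L ^ 2 ≤ ε * a ^ 4 / 100 :=
      calc L ^ 2 = L * L := sq L
        _ ≤ 1 * (ε * a ^ 4 / 100) :=
          mul_le_mul (min_le_left _ _) (min_le_right _ _) hL0.le zero_le_one
        _ = _ := one_mul _
    rw [div_lt_iff₀ (by positivity)]
    have : 0 < ε * a ^ 4 := by positivity
    linarith
  obtain ⟨δ, hδ, hδR⟩ := Metric.continuousAt_iff.1 (hRc.continuousAt (x := θ₀)) (L / 2)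
    (by positivity)
  have hsqrt : Tendsto (fun n => √(M n : ℝ)) atTop atTop :=
    Real.tendsto_sqrt_atTop.comp (tendsto_natCast_atTop_atTop.comp hM)
  have hev1 := (hsqrt.atTop_mul_const hL0).eventually_ge_atTop a
  have hev2 := (hsqrt.atTop_mul_const ha0).eventually_ge_atTop 1
  have hev3 := (hθt δ hδ).eventually_lt_const (u := ε / 2) (by positivity)
  obtain ⟨n₀, hn₀⟩ := eventually_atTop.1 (hev1.and (hev2.and hev3))
  refine ⟨n₀, fun n hn => ?_⟩
  obtain ⟨h1, h2, h3⟩ := hn₀ n hn.le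
  rw [Real.dist_eq, sub_zero, abs_of_nonneg measureReal_nonneg]
  have hmax := measureReal_exists_lt_abs_empiricalProcess_sub_le (hX n) (hmap n) (hind n)
    (g := fun x u => g n x (e.symm u)) (fun u => hg n _) (fun x u => hg01 n x _)
    (fun x => (hmono n x).comp e.symm.monotone) (hlip n) (b := e θ₀ - L / 2) ha0 hL0 h1 h2
  refine lt_of_le_of_lt ((measureReal_mono ?_).trans (measureReal_union_le _ _))
    (add_lt_add (hmax.trans_lt hLb) h3 |>.trans_eq (add_halves ε))
  intro ω hω
  by_contra hn
  simp only [Set.mem_union, Set.mem_ofPred_eq, not_or, not_exists, not_and, not_lt, not_le,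
    Real.norm_eq_abs] at hn
  obtain ⟨hn1, hn2⟩ := hn
  have hR : |e (θt n ω) - e θ₀| < L / 2 := hδR (by rwa [Real.dist_eq])
  rw [abs_lt] at hR
  have b1 := hn1 (e (θt n ω)) ⟨by linarith, by linarith⟩
  have b2 := hn1 (e θ₀) ⟨by linarith, by linarith⟩
  rw [e.symm_apply_apply] at b1 b2
  have hω' : η ≤ |(empiricalProcess (μ n) (M n) (fun i => X n i ω)
      (fun x => g n x (θt n ω) - g n x θ₀))| := by simpa using hω
  rw [empiricalProcess_sub (hgi n _) (hgi n _)] at hω'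
  rw [abs_le] at b1 b2
  have : |(empiricalProcess (μ n) (M n) (fun i => X n i ω) (fun x => g n x (θt n ω))
      - empiricalProcess (μ n) (M n) (fun i => X n i ω) (fun x => g n x θ₀))| ≤ 20 * a :=
    abs_le.2 ⟨by linarith, by linarith⟩
  linarith

/-! ### The conditional distribution function and its mean -/

theorem continuous_measureReal_Iio {ν : Measure ℝ} [IsFiniteMeasure ν] [NullSingletonClass ν] :
    Continuous fun θ => ν.real (Set.Iio θ) := by
  have e : (fun θ => ν.real (Set.Iio θ))
      = fun θ => ∫ y, (Set.Iio θ).indicator (fun _ => (1 : ℝ)) y ∂ν := by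
    ext θ
    rw [integral_indicator_const _ measurableSet_Iio, smul_eq_mul, mul_one]
  rw [e, continuous_iff_continuousAt]
  intro θ₀
  refine continuousAt_of_dominated (bound := fun _ => 1)
    (Eventually.of_forall fun θ =>
      (measurable_const.indicator measurableSet_Iio).aestronglyMeasurable)
    (Eventually.of_forall fun θ => Eventually.of_forall fun y => ?_) (integrable_const 1) ?_
  · exact (norm_indicator_le_norm_self _ _).trans (by simp)
  · have hne : ∀ᵐ y ∂ν, y ≠ θ₀ := by simp [ae_iff]
    filter_upwards [hne] with y hy
    rcases lt_or_gt_of_ne hy with h | h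
    · refine (continuousAt_const (y := (1 : ℝ))).congr ?_
      filter_upwards [lt_mem_nhds h] with θ hθ
      rw [Set.indicator_of_mem (Set.mem_Iio.2 hθ)]
    · refine (continuousAt_const (y := (0 : ℝ))).congr ?_
      filter_upwards [gt_mem_nhds h] with θ hθ
      rw [Set.indicator_of_notMem (by simpa using hθ.le)]

/-- The law of `Y` is a mixture of its conditional laws, almost all of which are absolutely
continuous. -/
theorem IsCondDensity.noAtoms_map {Ω E : Type*} [MeasurableSpace Ω] [MeasurableSpace E]
    {P : Measure Ω} [IsFiniteMeasure P] {Y : Ω → ℝ} {S : Ω → E} {f : E → ℝ → ℝ}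
    (hf : IsCondDensity P Y S f) (hY : AEMeasurable Y P) (hS : AEMeasurable S P) :
    NullSingletonClass (P.map Y) := by
  refine ⟨fun y => ?_⟩
  rw [← condDistrib_comp_map hS hY, Measure.bind_apply (measurableSet_singleton y)
    (Kernel.aemeasurable _)]
  refine (lintegral_congr_ae ?_).trans lintegral_zero
  filter_upwards [hf.condDistrib_eq] with s hs
  rw [hs]
  exact withDensity_absolutelyContinuous _ _ (measure_singleton y)

section Imputation

variable {Ω : Type*} [MeasurableSpace Ω] {P : Measure Ω} [IsProbabilityMeasure P] {p r : ℕ}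
  {Y : Ω → ℝ} {X : Ω → Fin p → ℝ} (A : Matrix (Fin p) (Fin r) ℝ)

theorem measurable_transpose_mulVec : Measurable fun x : Fin p → ℝ => Aᵀ *ᵥ x :=
  (Continuous.matrix_mulVec continuous_const continuous_id).measurable

theorem condMeanImputation_eq (τ : ℝ) (x : Fin p → ℝ) (θ : ℝ) :
    condMeanImputation P τ Y X A x θ
      = (condDistrib Y (reducedCovariate A X) P (Aᵀ *ᵥ x)).real (Set.Iio θ) - τ := by
  simp only [condMeanImputation, quantileScore]
  rw [integral_sub ((integrable_const _).indicator measurableSet_Iio) (integrable_const _),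
    integral_indicator_const _ measurableSet_Iio]
  simp

theorem measurable_condDistrib_mulVec_real (θ : ℝ) : Measurable fun x : Fin p → ℝ =>
    (condDistrib Y (reducedCovariate A X) P (Aᵀ *ᵥ x)).real (Set.Iio θ) :=
  ((Kernel.measurable_coe _ measurableSet_Iio).comp (measurable_transpose_mulVec A)).ennreal_toReal

/-- Total probability: the mean forgets `X` and `A`, which gives one function `H` for the whole
triangular array. -/
theorem integral_condDistrib_mulVec_real (hY : Measurable Y) (hX : Measurable X) (θ : ℝ) :
    ∫ x, (condDistrib Y (reducedCovariate A X) P (Aᵀ *ᵥ x)).real (Set.Iio θ) ∂(P.map X)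
      = (P.map Y).real (Set.Iio θ) := by
  have hS : Measurable (reducedCovariate A X) := (measurable_transpose_mulVec A).comp hX
  rw [integral_map hX.aemeasurable
    (measurable_condDistrib_mulVec_real A θ).aestronglyMeasurable]
  simp only [measureReal_def]
  rw [integral_toReal (f := fun ω => condDistrib Y (reducedCovariate A X) P (Aᵀ *ᵥ X ω)
      (Set.Iio θ)) ((Kernel.measurable_coe _ measurableSet_Iio).comp hS).aemeasurable
    (Eventually.of_forall fun ω => measure_lt_top _ _)]
  congr 1
  have := setLIntegral_preimage_condDistrib (μ := P) hS hY.aemeasurable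
    (measurableSet_Iio (a := θ)) MeasurableSet.univ
  rw [Set.preimage_univ, Measure.restrict_univ, Set.univ_inter] at this
  rw [Measure.map_apply hY measurableSet_Iio, ← this]
  rfl

end Imputation

namespace IsSemiSupervisedSample

variable {Ω E : Type*} [MeasurableSpace Ω] [MeasurableSpace E] {P : Measure Ω}
  {Y : Ω → ℝ} {X : Ω → E} {n N : ℕ} {Ys : ℕ → Ω → ℝ} {Xs : ℕ → Ω → E}

theorem identDistrib (h : IsSemiSupervisedSample P Y X n N Ys Xs) {i : ℕ} (hi : i < n + N) :
    IdentDistrib (Xs i) X P P := by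
  rcases lt_or_ge i n with hn | hn
  · exact (h.labelled_identDistrib i hn).comp measurable_snd
  · exact h.unlabelled_identDistrib i hn hi

theorem iIndepFun_labelled (h : IsSemiSupervisedSample P Y X n N Ys Xs) :
    iIndepFun (fun (i : Fin n) => Xs i) P :=
  h.labelled_iIndepFun.comp (fun _ => Prod.snd) fun _ => measurable_snd

theorem iIndepFun (h : IsSemiSupervisedSample P Y X n N Ys Xs) :
    iIndepFun (fun (i : Fin (n + N)) => Xs i) P :=
  iIndepFun_fin_add h.iIndepFun_labelled h.unlabelled_iIndepFun
    (h.indepFun.comp (φ := fun (z : Fin n → ℝ × E) i => (z i).2) (ψ := id)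
      (measurable_pi_lambda _ fun i => measurable_snd.comp (measurable_pi_apply i)) measurable_id)

end IsSemiSupervisedSample

/-! ### The imputation condition -/

theorem proposition2 {Ω : Type*} [MeasurableSpace Ω] (P : Measure Ω) [IsProbabilityMeasure P]
    (τ : ℝ) (hτ : τ ∈ Set.Ioo (0 : ℝ) 1) (r : ℕ) (p N : ℕ → ℕ)
    (Y : Ω → ℝ) (hY : Measurable Y)
    (X : ∀ n, Ω → Fin (p n) → ℝ) (hX : ∀ n, Measurable (X n))
    (Ys : ℕ → ℕ → Ω → ℝ) (Xs : ∀ n, ℕ → Ω → Fin (p n) → ℝ)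
    (hsample : ∀ n, IsSemiSupervisedSample P Y (X n) n (N n) (Ys n) (Xs n))
    (θ₀ : ℝ) (hθ₀ : ∫ ω, quantileScore τ (Y ω) θ₀ ∂P = 0)
    (P₀ : ∀ n, Matrix (Fin (p n)) (Fin r) ℝ)
    (f : ℕ → (Fin r → ℝ) → ℝ → ℝ)
    (hf : ∀ n, IsCondDensity P Y (reducedCovariate (P₀ n) (X n)) (f n))
    (ε : ℝ) (hε : 0 < ε)
    (hsup : ∀ n, ∫⁻ ω, (⨆ θ ∈ Metric.closedBall θ₀ ε,
      ENNReal.ofReal (f n (reducedCovariate (P₀ n) (X n) ω) θ)) ^ 2 ∂P < ∞) :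
    ImputationCondition P θ₀ N X Xs (fun n => condMeanImputation P τ Y (X n) (P₀ n)) := by
  have hν : IsProbabilityMeasure (P.map Y) := Measure.isProbabilityMeasure_map hY.aemeasurable
  have hμ : ∀ n, IsProbabilityMeasure (P.map (X n)) := fun n =>
    Measure.isProbabilityMeasure_map (hX n).aemeasurable
  have hS : ∀ n, Measurable (reducedCovariate (P₀ n) (X n)) := fun n =>
    (measurable_transpose_mulVec (P₀ n)).comp (hX n)
  -- The law of `Y` does not depend on `n`, so the density at a single index suffices.
  have hatoms : NullSingletonClass (P.map Y) := (hf 0).noAtoms_map hY.aemeasurable (hS 0).aemeasurable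
  set g : ∀ n, (Fin (p n) → ℝ) → ℝ → ℝ := fun n x θ =>
    (condDistrib Y (reducedCovariate (P₀ n) (X n)) P ((P₀ n)ᵀ *ᵥ x)).real (Set.Iio θ) with hg
  have hg01 : ∀ n x θ, g n x θ ∈ Set.Icc (0 : ℝ) 1 := fun n x θ =>
    ⟨measureReal_nonneg, measureReal_le_one⟩
  have hgm : ∀ n θ, Measurable fun x => g n x θ := fun n θ =>
    measurable_condDistrib_mulVec_real (P₀ n) θ
  refine ⟨fun n => ?_, fun θt _ hθt => ?_⟩
  · refine MemLp.of_bound (C := 1 + |τ|) ?_ (Eventually.of_forall fun ω => ?_)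
    · simp only [condMeanImputation_eq]
      exact (((hgm n θ₀).comp (hX n)).sub_const τ).aestronglyMeasurable
    · simp only [condMeanImputation_eq]
      refine (norm_sub_le _ _).trans (add_le_add ?_ le_rfl)
      rw [Real.norm_eq_abs, abs_of_nonneg measureReal_nonneg]
      exact measureReal_le_one
  · simp only [condMeanImputation_eq, sub_sub_sub_cancel_right]
    have key : ∀ M : ℕ → ℕ, Tendsto M atTop atTop → (∀ n, M n ≤ n + N n) →
        (∀ n, iIndepFun (fun (i : Fin (M n)) => Xs n i) P) →
        TendstoInMeasure P (fun n ω => empiricalProcess (P.map (X n)) (M n) (fun i => Xs n i ω)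
          (fun x => g n x (θt n ω) - g n x θ₀)) atTop (fun _ => 0) := by
      intro M hM hMN hind
      exact tendstoInMeasure_empiricalProcess_sub hM
        (fun n i hi => ((hsample n).identDistrib (hi.trans_le (hMN n))).aemeasurable_fst)
        (fun n i hi => ((hsample n).identDistrib (hi.trans_le (hMN n))).map_eq)
        hind hgm hg01
        (fun n x _ _ hθ => measureReal_mono (Set.Iio_subset_Iio hθ))
        (continuous_measureReal_Iio (ν := P.map Y))
        (fun _ _ hθ => measureReal_mono (Set.Iio_subset_Iio hθ))
        (fun n θ => integral_condDistrib_mulVec_real (P₀ n) hY (hX n) θ) hθt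
    exact ⟨key id tendsto_id (fun n => Nat.le_add_right _ _) fun n =>
        (hsample n).iIndepFun_labelled,
      key (fun n => n + N n) (tendsto_atTop_mono (fun n => Nat.le_add_right _ _) tendsto_id)
        (fun n => le_rfl) fun n => (hsample n).iIndepFun⟩
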